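/- Let $S$ be a scheme locally of finite type over $\mathbb{C}$, and let $G$ be a subgroup of the group $\mathrm{Aut}_{\mathbb{C}}(S)$ of automorphisms of $S$ over $\mathbb{C}$. Assume that $G$ satisfies the principle of analytic continuation: two elements $g,h\in G$ which coincide on some nonempty étale open $u:U\to S$ (that is, $g\circ u$ and $h\circ u$ are equal as maps of points; this is coincidence on the étale site of $U$, which does not see nilpotents) are equal. If $S$ is reduced, this assumption on $G$ may be dropped. Give $S(\mathbb{C})$ its analytic topology, $\mathrm{Aut}_{\mathbb{C}}(S)$ the compact-open topology coming from its action on $S(\mathbb{C})$, and $G$ the subspace topology. Let $H\subseteq G$ be a finite subgroup (for instance the holonomy group $\mathrm{hol}(T)$ of an $(S,G)$-structure on a scheme $T$, when it is finite), and let $\rho:H\to G$ be a homomorphism with image $\rho(H)=H$ (for instance the inclusion). Let $I\subseteq\mathbb{R}$ be an interval containing $0$, and let $(\rho_t)_{t\in I}$ be a continuous deformation of $\rho$: each $\rho_t:H\to G$ is a homomorphism, $\rho_0=\rho$, and for every $\gamma\in H$ the map $t\mapsto\rho_t(\gamma)$ from $I$ to $G$ is continuous. Then there is an open interval $J$ containing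 $0$, contained in $I$ if $I$ is a neighbourhood of $0$, such that for every $t\in I\cap J$ the representation $\rho_t$ is isomorphic to $\rho$, in the sense that $\rho_t(\gamma)\mapsto\rho(\gamma)$ is a well-defined isomorphism of groups from $\rho_t(H)$ onto $\rho(H)$. -/

import Mathlib

open CategoryTheory AlgebraicGeometry Topology

namespace ComplexScheme

/-- The spectrum of the field of complex numbers. -/
noncomputable abbrev specC : Scheme.{0} := Spec (CommRingCat.of ℂ)

/-- The set `S(ℂ)` of complex points of a scheme `S` over `ℂ`: the sections `Spec ℂ ⟶ S` of the
structure morphism. -/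
def Points (S : Over specC) : Type := Over.mk (𝟙 specC) ⟶ S

/-- The underlying morphism of schemes `Spec ℂ ⟶ S` of a complex point. -/
def Points.toHom {S : Over specC} (x : Points S) : specC ⟶ S.left := CommaMorphism.left x

/-- The value `f(x) ∈ ℂ` of a regular function `f ∈ Γ(S, U)` at a complex point `x` of the open
subscheme `U`. -/
noncomputable def Points.eval {S : Over specC} (x : Points S) (U : S.left.Opens)
    (hx : ⊤ ≤ x.toHom ⁻¹ᵁ U) (f : Γ(S.left, U)) : ℂ :=
  (Scheme.ΓSpecIso (CommRingCat.of ℂ)).hom (x.toHom.appLE U ⊤ hx f)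

/-- The set of those complex points `x` of the open subscheme `U` for which `f(x) ∈ W`. -/
def basicSet (S : Over specC) (U : S.left.Opens) (f : Γ(S.left, U)) (W : Set ℂ) :
    Set (Points S) :=
  {x | ∃ hx : ⊤ ≤ x.toHom ⁻¹ᵁ U, x.eval U hx f ∈ W}

/-- The analytic topology on `S(ℂ)`: the coarsest topology for which `U(ℂ)` is open and every
regular function `U(ℂ) → ℂ` is continuous, for each Zariski open `U`. On an affine open `U`
of finite type this is the subspace topology of any closed embedding `U(ℂ) ⊆ ℂⁿ`. -/
instance analyticTopology (S : Over specC) : TopologicalSpace (Points S) :=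
  TopologicalSpace.generateFrom
    {A | ∃ (U : S.left.Opens) (f : Γ(S.left, U)) (W : Set ℂ), IsOpen W ∧ A = basicSet S U f W}

/-- The image of a complex point under a morphism of schemes over `ℂ`. -/
noncomputable def Points.map {S T : Over specC} (φ : S ⟶ T) (x : Points S) : Points T :=
  CategoryStruct.comp (obj := Over specC) x φ

theorem Points.toHom_map {S T : Over specC} (φ : S ⟶ T) (x : Points S) :
    (x.map φ).toHom = x.toHom ≫ φ.left := rfl

theorem Points.continuous_map {S T : Over specC} (φ : S ⟶ T) :
    Continuous (Points.map φ) := by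
  refine continuous_generateFrom_iff.2 ?_
  rintro _ ⟨U, f, W, hW, rfl⟩
  refine TopologicalSpace.isOpen_generateFrom_of_mem ⟨φ.left ⁻¹ᵁ U, φ.left.app U f, W, hW, ?_⟩
  ext x
  refine exists_congr fun hx => ?_
  have key : (x.map φ).eval U hx f = x.eval (φ.left ⁻¹ᵁ U) hx (φ.left.app U f) := by
    unfold Points.eval
    congr 1
  rw [key]

/-- The continuous self-map of `S(ℂ)` given by an automorphism of `S` over `ℂ`. -/
noncomputable def autMap (S : Over specC) (g : Aut S) : C(Points S, Points S) :=
  ⟨Points.map g.hom, Points.continuous_map g.hom⟩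

/-- The compact-open topology on the group of automorphisms of `S` over `ℂ`, with respect to the
analytic topology of `S(ℂ)`. A subgroup carries the subspace topology. -/
noncomputable instance autTopology (S : Over specC) : TopologicalSpace (Aut S) :=
  TopologicalSpace.induced (autMap S) ContinuousMap.compactOpen

/-- The principle of analytic continuation for a group `G` of automorphisms of `S` acting on the
étale site of `S`: two elements of `G` which coincide on some nonempty étale open of `S`
are equal. Since the étale site does not see nilpotents, `g` and `h` coincide on `u : U ⟶ S`
when `g ∘ u` and `h ∘ u` are the same map of points. -/
def AnalyticContinuation {S : Over specC} (G : Subgroup (Aut S)) : Prop :=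
  ∀ g ∈ G, ∀ h ∈ G, ∀ (U : Scheme.{0}) (u : U ⟶ S.left), Nonempty U → Etale u →
    (∀ x : U, g.hom.left (u x) = h.hom.left (u x)) → g = h

end ComplexScheme

/-- `ρ'` is isomorphic to `ρ`: the correspondence `ρ' γ ↦ ρ γ` is a well-defined isomorphism from
the group `ρ'(Γ)` onto the group `ρ(Γ)`. -/
def IsIsomorphicRep {Γ G : Type*} [Group Γ] [Group G] (ρ' ρ : Γ →* G) : Prop :=
  ∃ e : ρ'.range ≃* ρ.range, ∀ γ : Γ, e (ρ'.rangeRestrict γ) = ρ.rangeRestrict γ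

namespace ComplexScheme

/-! A surjective endomorphism of a finite group is injective, so `ρ` is injective. Injective
representations of the same group are isomorphic in the required sense, so it suffices that
injectivity persists for small `t`. There are finitely many `γ ≠ 1`, and each condition `ρ_t γ ≠ 1`
is open in `t` once `{1}` is closed in `G` (`isClosed_one`). For that, `{1}` is the intersection of
the stabilizers of the complex points. Each stabilizer is closed because evaluation is continuous
and `S(ℂ)` is T1. The intersection is trivial (`eq_one_of_map_eq`): closed points determine a
continuous self-map of the Jacobson space `S`, and analytic continuation or reducedness then
determines the morphism. -/

theorem Points.toHom_comp {S : Over specC} (x : Points S) : x.toHom ≫ S.hom = 𝟙 specC :=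
  Over.w (show Over.mk (𝟙 specC) ⟶ S from x)

/-- The point of the underlying space of `S` at which a complex point is supported. -/
noncomputable def Points.toPoint {S : Over specC} (x : Points S) : S.left :=
  x.toHom (IsLocalRing.closedPoint ℂ)

theorem Points.toPoint_map {S T : Over specC} (φ : S ⟶ T) (x : Points S) :
    (x.map φ).toPoint = φ.left x.toPoint :=
  Scheme.Hom.comp_apply x.toHom φ.left _

theorem Points.isClosed_toPoint {S : Over specC} [LocallyOfFiniteType S.hom] (x : Points S) :
    IsClosed {x.toPoint} :=
  (pointEquivClosedPoint (K := ℂ) S.hom ⟨x.toHom, x.toHom_comp⟩).2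

theorem Points.toPoint_injective (S : Over specC) [LocallyOfFiniteType S.hom] :
    Function.Injective (Points.toPoint (S := S)) := fun x y h =>
  Over.OverMorphism.ext (ext_of_apply_closedPoint_eq (K := ℂ) S.hom x.toHom_comp y.toHom_comp h)

/-- Every closed point supports a complex point. -/
theorem Points.exists_toPoint_eq {S : Over specC} [LocallyOfFiniteType S.hom] {s : S.left}
    (hs : IsClosed {s}) : ∃ x : Points S, x.toPoint = s :=
  ⟨Over.homMk (U := Over.mk (𝟙 specC)) (pointOfClosedPoint (K := ℂ) S.hom s hs)
    (pointOfClosedPoint_comp (K := ℂ) S.hom s hs),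
    pointOfClosedPoint_apply (K := ℂ) S.hom s hs _⟩

/-- The analytic topology is finer than the Zariski topology. -/
theorem Points.continuous_toPoint (S : Over specC) :
    Continuous (Points.toPoint (S := S)) := by
  refine continuous_def.2 fun U hU => ?_
  -- With `f = 0` and `W = univ` the basic set is all of `U(ℂ)`.
  refine TopologicalSpace.isOpen_generateFrom_of_mem ⟨⟨U, hU⟩, 0, Set.univ, isOpen_univ, ?_⟩
  ext x
  refine ⟨fun hx => ⟨fun p _ => ?_, trivial⟩, fun ⟨hx, _⟩ => hx (Set.mem_univ _)⟩
  rw [Subsingleton.elim (α := PrimeSpectrum ℂ) p (IsLocalRing.closedPoint ℂ)]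
  exact hx

/-- T1 is all that closed stabilizers need; `S(ℂ)` may fail to be Hausdorff, as `S` need not be
separated. -/
instance (S : Over specC) [LocallyOfFiniteType S.hom] : T1Space (Points S) where
  t1 x := by
    rw [← (Points.toPoint_injective S).preimage_image {x}, Set.image_singleton]
    exact x.isClosed_toPoint.preimage (Points.continuous_toPoint S)

/-- Evaluation of automorphisms at a complex point is continuous. -/
theorem continuous_aut_apply {S : Over specC} (x : Points S) :
    Continuous fun g : Aut S => x.map g.hom :=
  (continuous_eval_const (F := C(Points S, Points S)) x).comp
    (continuous_induced_dom (f := autMap S))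

end ComplexScheme

/-- Continuous maps from a Jacobson space to a T0 space agreeing on closed points are equal. -/
theorem Continuous.ext_on_closedPoints {X Y : Type*} [TopologicalSpace X] [TopologicalSpace Y]
    [JacobsonSpace X] [T0Space Y] {f g : X → Y} (hf : Continuous f) (hg : Continuous g)
    (h : Set.EqOn f g (closedPoints X)) : f = g := by
  have key : ∀ {f g : X → Y}, Continuous f → Continuous g → Set.EqOn f g (closedPoints X) →
      ∀ U : Set Y, IsOpen U → ∀ x, f x ∈ U → g x ∈ U := by
    intro f g hf hg h U hU x hx
    by_contra hgx
    -- In a Jacobson space every nonempty locally closed set contains a closed point.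
    obtain ⟨y, ⟨hy, hy'⟩, hyc⟩ := nonempty_inter_closedPoints
      (Z := f ⁻¹' U ∩ (g ⁻¹' U)ᶜ) ⟨x, hx, hgx⟩
      ((hU.preimage hf).isLocallyClosed.inter (hU.preimage hg).isClosed_compl.isLocallyClosed)
    exact hy' (show g y ∈ U from h hyc ▸ hy)
  funext x
  exact (inseparable_iff_forall_isOpen.2 fun U hU =>
    ⟨key hf hg h U hU x, key hg hf h.symm U hU x⟩).eq

open Limits in
/-- Two morphisms from a reduced scheme over an algebraically closed field which agree as maps of
points are equal. -/
theorem AlgebraicGeometry.ext_of_apply_eq_of_isReduced.{u} {X Y : Scheme.{u}} {K : Type u} [Field K]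
    [IsAlgClosed K] {f g : X ⟶ Y} (i : Y ⟶ Spec (.of K)) [LocallyOfFiniteType i] [IsReduced X]
    [LocallyOfFiniteType (f ≫ i)] (H : ∀ x, f x = g x) (H' : f ≫ i = g ≫ i) : f = g := by
  -- `Y` need not be separated, but its affine charts are. Agreement on points makes `g` send
  -- `f⁻¹(V)` into `V` too, so both restrictions factor through the chart.
  suffices hloc : ∀ (V : Scheme.{u}) (c : V ⟶ Y) [IsOpenImmersion c] [IsAffine V],
      pullback.fst f c ≫ f = pullback.fst f c ≫ g from
    Scheme.Cover.hom_ext (Y.affineCover.pullback₁ f) _ _ fun (j : Y.affineCover.I₀) =>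
      hloc _ (Y.affineCover.f j)
  intro V c _ _
  have : IsReduced (pullback f c) := isReduced_of_isOpenImmersion (pullback.fst f c)
  have hfg : ∀ x, (pullback.fst f c ≫ g) x = c (pullback.snd f c x) := fun x => by
    rw [← Scheme.Hom.comp_apply, ← pullback.condition, Scheme.Hom.comp_apply, Scheme.Hom.comp_apply,
      H]
  have hr : Set.range (pullback.fst f c ≫ g) ⊆ Set.range c := by
    rintro _ ⟨x, rfl⟩
    exact ⟨_, (hfg x).symm⟩
  have hl := IsOpenImmersion.lift_fac c (pullback.fst f c ≫ g) hr
  have hw : pullback.snd f c ≫ c ≫ i = pullback.fst f c ≫ f ≫ i := by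
    rw [pullback.condition_assoc]
  have : LocallyOfFiniteType (pullback.snd f c ≫ c ≫ i) := by rw [hw]; infer_instance
  have key : pullback.snd f c = IsOpenImmersion.lift c (pullback.fst f c ≫ g) hr := by
    refine ext_of_apply_eq (c ≫ i) Set.univ isOpen_univ.isLocallyClosed dense_univ
      (fun x _ _ => c.isOpenEmbedding.injective ?_) ?_
    · rw [← hfg, ← Scheme.Hom.comp_apply, hl]
    · rw [hw, reassoc_of% hl, H']
  rw [pullback.condition, key, hl]

namespace ComplexScheme

/-- An automorphism fixing all complex points fixes all points. -/
theorem left_apply_eq_of_map_eq {S : Over specC} [LocallyOfFiniteType S.hom] {g : Aut S}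
    (h : ∀ x : Points S, x.map g.hom = x) (s : S.left) : g.hom.left s = s := by
  have : JacobsonSpace S.left := LocallyOfFiniteType.jacobsonSpace S.hom
  refine congrFun (Continuous.ext_on_closedPoints (g := id) g.hom.left.continuous continuous_id
    fun t ht => ?_) s
  obtain ⟨x, rfl⟩ := Points.exists_toPoint_eq ht
  rw [← Points.toPoint_map, h x, id]

/-- A group of automorphisms which satisfies the principle of analytic continuation, or which acts
on a reduced scheme, acts faithfully on complex points. -/
theorem eq_one_of_map_eq {S : Over specC} [LocallyOfFiniteType S.hom] {G : Subgroup (Aut S)}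
    (hG : AnalyticContinuation G ∨ IsReduced S.left) {g : Aut S} (hg : g ∈ G)
    (h : ∀ x : Points S, x.map g.hom = x) : g = 1 := by
  have hS := left_apply_eq_of_map_eq h
  rcases hG with hG | hG
  · rcases isEmpty_or_nonempty S.left with hE | hN
    -- Analytic continuation is silent on the empty scheme, but its only automorphism is the
    -- identity.
    · exact Aut.ext (Over.OverMorphism.ext (isInitialOfIsEmpty.hom_ext _ _))
    · exact hG g hg 1 G.one_mem S.left (𝟙 S.left) hN inferInstance fun x => hS x
  · have e : g.hom.left ≫ S.hom = S.hom := Over.w g.hom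
    have : LocallyOfFiniteType (g.hom.left ≫ S.hom) := by rw [e]; infer_instance
    exact Aut.ext (Over.OverMorphism.ext (ext_of_apply_eq_of_isReduced (K := ℂ) S.hom hS
      (e.trans (Category.id_comp _).symm)))

/-- In a group of automorphisms acting faithfully on complex points, the identity is closed. -/
theorem isClosed_one {S : Over specC} [LocallyOfFiniteType S.hom] {G : Subgroup (Aut S)}
    (hG : AnalyticContinuation G ∨ IsReduced S.left) : IsClosed ({1} : Set G) := by
  have : ({1} : Set G) = ⋂ x : Points S, {g : G | x.map (g : Aut S).hom = x} := by
    ext g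
    simp only [Set.mem_singleton_iff, Set.mem_iInter, Set.mem_ofPred_eq]
    refine ⟨?_, fun h => Subtype.ext (eq_one_of_map_eq hG g.2 h)⟩
    rintro rfl x
    exact Category.comp_id (obj := Over specC) x
  rw [this]
  exact isClosed_iInter fun x => isClosed_singleton.preimage
    ((continuous_aut_apply x).comp continuous_subtype_val)

end ComplexScheme

/-- Injective homomorphisms from the same group are isomorphic representations. -/
theorem IsIsomorphicRep.of_injective {Γ G : Type*} [Group Γ] [Group G] {ρ' ρ : Γ →* G}
    (h' : Function.Injective ρ') (h : Function.Injective ρ) : IsIsomorphicRep ρ' ρ :=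
  ⟨(MonoidHom.ofInjective h').symm.trans (MonoidHom.ofInjective h), fun γ => by
    have : ρ'.rangeRestrict γ = MonoidHom.ofInjective h' γ := rfl
    rw [this, MulEquiv.trans_apply, MulEquiv.symm_apply_apply]
    rfl⟩

/-- If the identity of `G` is closed, then injectivity is an open condition on continuous families
of homomorphisms from a finite group to `G`. -/
theorem MonoidHom.eventually_injective {Γ G X : Type*} [Group Γ] [Finite Γ] [Group G]
    [TopologicalSpace G] [TopologicalSpace X] (h1 : IsClosed ({1} : Set G)) {ρ : X → Γ →* G}
    (hρ : ∀ γ, Continuous fun t => ρ t γ) {t₀ : X} (h₀ : Function.Injective (ρ t₀)) :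
    ∀ᶠ t in 𝓝 t₀, Function.Injective (ρ t) := by
  have : ∀ γ : Γ, ∀ᶠ t in 𝓝 t₀, ρ t γ = 1 → γ = 1 := by
    intro γ
    by_cases hγ : γ = 1
    · exact .of_forall fun _ _ => hγ
    · have hne : ρ t₀ γ ∈ ({1} : Set G)ᶜ := fun h => hγ (h₀ (h.trans (map_one _).symm))
      filter_upwards [(hρ γ).continuousAt.eventually_mem (h1.isOpen_compl.mem_nhds hne)]
        with t ht h
      exact absurd h ht
  filter_upwards [Filter.eventually_all.2 this] with t ht
  exact (injective_iff_map_eq_one _).2 ht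

theorem mainTheorem3 (S : Over ComplexScheme.specC) [LocallyOfFiniteType S.hom]
    (G : Subgroup (Aut S))
    (hG : ComplexScheme.AnalyticContinuation G ∨ AlgebraicGeometry.IsReduced S.left)
    (hol : Subgroup G) [Finite hol]
    (ρ : hol →* G) (hρ : ρ.range = hol)
    (I : Set ℝ) (hI : I.OrdConnected) (h0 : (0 : ℝ) ∈ I)
    (ρt : I → (hol →* G)) (hρt0 : ρt ⟨0, h0⟩ = ρ)
    (hcont : ∀ γ : hol, Continuous fun t : I => ρt t γ) :
    ∃ a b : ℝ, a < 0 ∧ 0 < b ∧ (I ∈ 𝓝 (0 : ℝ) → Set.Ioo a b ⊆ I) ∧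
      ∀ t : I, (t : ℝ) ∈ Set.Ioo a b → IsIsomorphicRep (ρt t) ρ := by
  have hinj : Function.Injective ρ := by
    -- The hypothesis `ρ.range = hol` turns `ρ` into a surjective endomorphism of the finite group
    -- `hol`.
    have hsurj : Function.Surjective
        ((MulEquiv.subgroupCongr hρ).toMonoidHom.comp ρ.rangeRestrict) :=
      (MulEquiv.subgroupCongr hρ).surjective.comp ρ.rangeRestrict_surjective
    exact fun x y h => Finite.injective_iff_surjective.2 hsurj (Subtype.ext h)
  have hev := MonoidHom.eventually_injective (ComplexScheme.isClosed_one hG) hcont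
    (t₀ := ⟨0, h0⟩) (hρt0 ▸ hinj)
  obtain ⟨ε, hε, hball⟩ := Metric.eventually_nhds_iff.1 hev
  obtain ⟨δ, hδ, hδI⟩ : ∃ δ > 0, I ∈ 𝓝 (0 : ℝ) → Metric.ball (0 : ℝ) δ ⊆ I := by
    by_cases h : I ∈ 𝓝 (0 : ℝ)
    · obtain ⟨δ, hδ, hsub⟩ := Metric.mem_nhds_iff.1 h
      exact ⟨δ, hδ, fun _ => hsub⟩
    -- When `I` is not a neighbourhood of `0`, nothing constrains `δ`.
    · exact ⟨1, one_pos, fun h' => absurd h' h⟩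
  have hm : 0 < min ε δ := lt_min hε hδ
  refine ⟨-min ε δ, min ε δ, neg_lt_zero.2 hm, hm, fun h t ht => hδI h ?_, fun t ht => ?_⟩
  · rw [mem_ball_zero_iff, Real.norm_eq_abs]
    exact (abs_lt.2 ht).trans_le (min_le_right _ _)
  · refine .of_injective (hball ?_) hinj
    rw [Subtype.dist_eq, Real.dist_eq, sub_zero]
    exact (abs_lt.2 ht).trans_le (min_le_left _ _)
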